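/- All graphs are finite, simple and undirected. For a graph $G$ and a vertex $v$, let $N[v]$ denote the closed neighbourhood of $v$ (the neighbours of $v$ together with $v$). The graph $G$ is twin-free if $N[u]\neq N[v]$ for all distinct vertices $u,v$. A set $\mathcal C$ of vertices is an identifying code of $G$ if every vertex outside $\mathcal C$ has a neighbour in $\mathcal C$ and $N[u]\cap\mathcal C\neq N[v]\cap\mathcal C$ for all distinct vertices $u,v$; for twin-free $G$, $\gamma^{\mathrm{ID}}(G)$ denotes the minimum size of an identifying code of $G$. A vertex $w$ is forced if there are vertices $u,v$ such that $u,v,w$ are distinct and $N[u]\,\Delta\, N[v]=\{w\}$. For a graph on $n\ge 1$ vertices, $f(G)$ is the number of non-forced vertices of $G$ divided by $n$. Let $d\geq 3$ be an integer and let $G$ be a twin-free graph on $n$ vertices. (i) If $G$ has no isolated vertices, $G$ has maximum degree $d$, and $f(G)=\frac1\alpha$ for some real number $\alpha\geq 1$, then $$\gamma^{\mathrm{ID}}(G)\leq n-\frac{n}{103\,\alpha^2 d}.$$ (ii) In particular, if $G$ is $d$-regular, then $G$ has no forced vertices and $$\gamma^{\mathrm{ID}}(G)\leq n-\frac{n}{103\,d}.$$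 -/

import Mathlib

namespace SimpleGraph

variable {V : Type*}

/-- The closed neighbourhood `N[v]`: the neighbours of `v` together with `v` itself. -/
def closedNbhd (G : SimpleGraph V) (v : V) : Set V :=
  insert v (G.neighborSet v)

/-- Two distinct vertices are twins if they have the same closed neighbourhood. -/
def Twins (G : SimpleGraph V) (u v : V) : Prop :=
  u ≠ v ∧ G.closedNbhd u = G.closedNbhd v

/-- A graph is twin-free if it has no pair of twins. -/
def TwinFree (G : SimpleGraph V) : Prop :=
  ∀ u v : V, ¬ G.Twins u v

/-- Every vertex outside `C` has at least one neighbour in `C`. -/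
def IsDominatingSet (G : SimpleGraph V) (C : Set V) : Prop :=
  ∀ v : V, v ∉ C → ∃ w ∈ C, G.Adj v w

/-- Any two distinct vertices have different traces of their closed neighbourhoods on `C`. -/
def IsSeparatingSet (G : SimpleGraph V) (C : Set V) : Prop :=
  ∀ u v : V, u ≠ v → G.closedNbhd u ∩ C ≠ G.closedNbhd v ∩ C

/-- An identifying code is a set of vertices that is both dominating and separating. -/
def IsIdentifyingCode (G : SimpleGraph V) (C : Set V) : Prop :=
  G.IsDominatingSet C ∧ G.IsSeparatingSet C

/-- A graph admits an identifying code if and only if it is twin-free; so the minimum defining the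
identifying code number of a finite twin-free graph is taken over a nonempty set. -/
theorem exists_isIdentifyingCode_iff_twinFree (G : SimpleGraph V) :
    (∃ C : Set V, G.IsIdentifyingCode C) ↔ G.TwinFree := by
  constructor
  · rintro ⟨C, -, hC⟩ u v ⟨huv, h⟩
    exact hC u v huv (by rw [h])
  · intro h
    refine ⟨Set.univ, fun v hv => (hv (Set.mem_univ v)).elim, fun u v huv he => ?_⟩
    rw [Set.inter_univ, Set.inter_univ] at he
    exact h u v ⟨huv, he⟩

/-- The identifying code number of a finite graph: the minimum size of an identifying code.
(It is only meaningful for twin-free graphs.) -/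
noncomputable def identifyingCodeNumber [Fintype V] (G : SimpleGraph V) : ℕ :=
  sInf {k : ℕ | ∃ C : Finset V, G.IsIdentifyingCode (C : Set V) ∧ C.card = k}

/-- For a finite twin-free graph the identifying code number is the size of some identifying
code, and no identifying code is smaller. -/
theorem TwinFree.isLeast_identifyingCodeNumber [Fintype V] {G : SimpleGraph V}
    (h : G.TwinFree) :
    IsLeast {k : ℕ | ∃ C : Finset V, G.IsIdentifyingCode (C : Set V) ∧ C.card = k}
      G.identifyingCodeNumber := by
  classical
  refine ⟨Nat.sInf_mem ?_, fun k hk => Nat.sInf_le hk⟩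
  obtain ⟨C, hC⟩ := (G.exists_isIdentifyingCode_iff_twinFree).2 h
  exact ⟨_, C.toFinset, by simpa using hC, rfl⟩

/-- A vertex `w` is forced if there are vertices `u`, `v` such that `u`, `v`, `w` are
distinct and `N[u] Δ N[v] = {w}`. -/
def IsForced (G : SimpleGraph V) (w : V) : Prop :=
  ∃ u v : V, u ≠ v ∧ u ≠ w ∧ v ≠ w ∧ symmDiff (G.closedNbhd u) (G.closedNbhd v) = {w}

/-- The proportion `f(G)` of non-forced vertices of `G`. -/
noncomputable def nonForcedProportion [Fintype V] (G : SimpleGraph V) : ℝ :=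
  ({v : V | ¬ G.IsForced v}.ncard : ℝ) / (Fintype.card V : ℝ)

end SimpleGraph

/-!
The complement of a vertex set `S` is an identifying code as soon as `S` contains no closed
neighbourhood `N[v]` and no symmetric difference `N[u] Δ N[v]` with `u ≠ v`. So the task is to find
a large independent set `S` in the hypergraph of these sets, and `S` is sought inside the set `W` of
non-forced vertices. Two observations make the hypergraph sparse enough for the deletion method.

* Twin-freeness, the absence of isolated vertices and the definition of a forced vertex together
  imply that every hyperedge inside `W` has at least two elements
  (`TwinFree.two_le_card_codeHyperedge`). The pairs `u, v` with disjoint closed neighbourhoods may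
  be ignored, since then `N[u] ⊆ N[u] Δ N[v]`.
* By double counting of common neighbours, a given vertex `u` has at most `(d + 1) ^ 2` partners `v`
  with `N[u] ∩ N[v] ≠ ∅`, and at most `3 (d + 1)` of these satisfy `|N[u] Δ N[v]| ≤ 2`, as such a `v`
  shares at least a third of `N[u]` with `u` (`card_small_symmDiff_le`).

Hence the hypergraph has `O(n d)` edges of size two, and its remaining `O(n d ^ 2)` edges have size
at least three. Select every vertex independently with probability `p` and drop one vertex of each
hyperedge that is entirely selected: some outcome leaves an independent set of size at least
`p |W| - O(p ^ 2 n d) - O(p ^ 3 n d ^ 2)` (`exists_independent_of_weight`). With `|W| = n / α` and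
`p = 1 / (10 α d)` this is at least `n / (103 α ^ 2 d)`.

In a regular graph all symmetric differences `N[u] Δ N[v]` have even size, so no vertex is forced
and `α = 1`.
-/

open Finset

/-! ### Independent sets in hypergraphs by random deletion -/

section Deletion

variable {V : Type*} [Fintype V] [DecidableEq V]

/-- A random subset of a finite type that contains each point independently with probability `p`
contains a given set `e` with probability `p ^ |e|`. -/
theorem sum_prob_superset (p : ℝ) (e : Finset V) :
    ∑ T : Finset V, (p ^ #T * (1 - p) ^ #Tᶜ) * (if e ⊆ T then 1 else 0) = p ^ #e := by
  have h := Finset.prod_add (fun _ : V => p) (fun i => if i ∈ e then 0 else 1 - p) univ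
  have hL : ∏ i : V, (p + if i ∈ e then 0 else 1 - p) = p ^ #e := by
    have : ∀ i : V, (p + if i ∈ e then 0 else 1 - p) = if i ∈ e then p else 1 := by
      intro i; split_ifs <;> ring
    simp only [this]
    rw [Finset.prod_ite_mem, univ_inter, prod_const]
  rw [hL] at h
  rw [h, Finset.powerset_univ]
  refine Finset.sum_congr rfl fun T _ => ?_
  rw [Finset.prod_const, ← Finset.compl_eq_univ_sdiff, mul_assoc]
  congr 1
  split_ifs with heT
  · rw [mul_one, ← prod_const]
    refine Finset.prod_congr rfl fun i hi => ?_
    rw [if_neg fun hie => mem_compl.1 hi (heT hie)]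
  · obtain ⟨i, hie, hiT⟩ := Finset.not_subset.1 heT
    rw [mul_zero, eq_comm]
    refine Finset.prod_eq_zero (mem_compl.2 hiT) ?_
    exact if_pos hie

/-- The deletion method: from a random subset of `W` of density `p`, remove one vertex of each
hyperedge that it contains. -/
theorem exists_independent_of_weight {ι : Type*} (W : Finset V) (E : Finset ι)
    (e : ι → Finset V) (he : ∀ i ∈ E, (e i).Nonempty) {p : ℝ} (hp0 : 0 ≤ p) (hp1 : p ≤ 1) :
    ∃ S ⊆ W, (∀ i ∈ E, ¬ e i ⊆ S) ∧ p * #W - ∑ i ∈ E, p ^ #(e i) ≤ (#S : ℝ) := by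
  classical
  set w : Finset V → ℝ := fun T => p ^ #T * (1 - p) ^ #Tᶜ with hw
  have hw0 : ∀ T, 0 ≤ w T := fun T =>
    mul_nonneg (pow_nonneg hp0 _) (pow_nonneg (by linarith) _)
  have hw1 : ∑ T, w T = 1 := by simpa using sum_prob_superset p (∅ : Finset V)
  -- The expected number of selected vertices of `W` minus the expected number of bad hyperedges.
  have hmean : ∑ T, w T * ((#(W ∩ T) : ℝ) - #{i ∈ E | e i ⊆ T}) =
      p * #W - ∑ i ∈ E, p ^ #(e i) := by
    have h1 : ∀ T : Finset V, (#(W ∩ T) : ℝ) = ∑ v ∈ W, if ({v} : Finset V) ⊆ T then 1 else 0 := by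
      intro T
      simp only [singleton_subset_iff]
      rw [Finset.sum_boole, Finset.filter_mem_eq_inter]
    have h2 : ∀ T : Finset V, (#{i ∈ E | e i ⊆ T} : ℝ) = ∑ i ∈ E, if e i ⊆ T then 1 else 0 := by
      intro T; rw [Finset.sum_boole]
    simp only [h1, h2, mul_sub, Finset.mul_sum, Finset.sum_sub_distrib]
    rw [Finset.sum_comm, Finset.sum_comm (t := E)]
    simp only [hw, sum_prob_superset]
    simp [mul_comm]
  obtain ⟨T, hT⟩ : ∃ T : Finset V,
      p * #W - ∑ i ∈ E, p ^ #(e i) ≤ (#(W ∩ T) : ℝ) - #{i ∈ E | e i ⊆ T} := by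
    by_contra! hlt
    set M := p * #W - ∑ i ∈ E, p ^ #(e i)
    obtain ⟨T₀, -, hT₀⟩ : ∃ T ∈ univ, 0 < w T := by
      by_contra! hle
      have := Finset.sum_nonpos hle
      linarith
    have : ∑ T, w T * ((#(W ∩ T) : ℝ) - #{i ∈ E | e i ⊆ T}) < ∑ T, w T * M :=
      Finset.sum_lt_sum (fun T _ => mul_le_mul_of_nonneg_left (hlt T).le (hw0 T))
        ⟨T₀, mem_univ _, mul_lt_mul_of_pos_left (hlt T₀) hT₀⟩
    rw [← Finset.sum_mul, hw1, one_mul, hmean] at this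
    exact lt_irrefl _ this
  -- One vertex of each bad hyperedge, as a singleton so that `V` may be empty.
  have hsing : ∀ i ∈ E, ∃ t ⊆ e i, #t = 1 := fun i hi =>
    Finset.exists_subset_card_eq (he i hi).card_pos
  choose! t hte ht1 using hsing
  set D : Finset V := {i ∈ E | e i ⊆ T}.biUnion t
  refine ⟨(W ∩ T) \ D, sdiff_subset.trans inter_subset_left, fun i hi hS => ?_, hT.trans ?_⟩
  · have hiT : e i ⊆ T := hS.trans (sdiff_subset.trans inter_subset_right)
    obtain ⟨x, hx⟩ : (t i).Nonempty := card_pos.1 (by rw [ht1 i hi]; exact one_pos)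
    exact (mem_sdiff.1 (hS (hte i hi hx))).2 (mem_biUnion.2 ⟨i, mem_filter.2 ⟨hi, hiT⟩, hx⟩)
  · have h1 := Finset.le_card_sdiff D (W ∩ T)
    have h2 : #D ≤ #{i ∈ E | e i ⊆ T} * 1 :=
      card_biUnion_le_card_mul _ _ _ fun i hi => (ht1 i (mem_filter.1 hi).1).le
    have h3 : #(W ∩ T) ≤ #((W ∩ T) \ D) + #{i ∈ E | e i ⊆ T} := by omega
    rw [sub_le_iff_le_add]
    exact_mod_cast h3

end Deletion

namespace SimpleGraph

variable {V : Type*} [Fintype V] [DecidableEq V] (G : SimpleGraph V) [DecidableRel G.Adj]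

/-! ### Counting pairs with intersecting closed neighbourhoods -/

/-- The closed neighbourhood as a `Finset`. -/
def closedNbhdFinset (v : V) : Finset V := insert v (G.neighborFinset v)

@[simp] theorem coe_closedNbhdFinset (v : V) :
    (G.closedNbhdFinset v : Set V) = G.closedNbhd v := by
  simp [closedNbhdFinset, closedNbhd]

theorem mem_closedNbhdFinset {v w : V} : w ∈ G.closedNbhdFinset v ↔ w = v ∨ G.Adj v w := by
  simp [closedNbhdFinset]

theorem mem_closedNbhdFinset_comm {v w : V} :
    w ∈ G.closedNbhdFinset v ↔ v ∈ G.closedNbhdFinset w := by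
  simp [mem_closedNbhdFinset, eq_comm, G.adj_comm]

theorem card_closedNbhdFinset (v : V) : #(G.closedNbhdFinset v) = G.degree v + 1 := by
  rw [closedNbhdFinset, card_insert_of_notMem (by simp), card_neighborFinset_eq_degree]

theorem sum_card_inter_closedNbhdFinset_le {d : ℕ} (hd : ∀ v, G.degree v ≤ d) (u : V) :
    ∑ v, #(G.closedNbhdFinset u ∩ G.closedNbhdFinset v) ≤ (G.degree u + 1) * (d + 1) := by
  have h1 : ∀ v, #(G.closedNbhdFinset u ∩ G.closedNbhdFinset v) =
      ∑ w ∈ G.closedNbhdFinset u, if v ∈ G.closedNbhdFinset w then 1 else 0 := by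
    intro v
    rw [Finset.sum_boole, ← Finset.filter_mem_eq_inter]
    simp only [G.mem_closedNbhdFinset_comm (v := v), Nat.cast_id]
  simp only [h1]
  rw [Finset.sum_comm]
  calc ∑ w ∈ G.closedNbhdFinset u, ∑ v, (if v ∈ G.closedNbhdFinset w then 1 else 0)
      ≤ ∑ w ∈ G.closedNbhdFinset u, (d + 1) := by
        refine Finset.sum_le_sum fun w _ => ?_
        have := hd w
        simp [card_closedNbhdFinset, this]
    _ = (G.degree u + 1) * (d + 1) := by
        rw [Finset.sum_const, card_closedNbhdFinset, smul_eq_mul]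

theorem card_closedNbhdFinset_inter_nonempty_le {d : ℕ} (hd : ∀ v, G.degree v ≤ d) (u : V) :
    #{v | (G.closedNbhdFinset u ∩ G.closedNbhdFinset v).Nonempty} ≤ (d + 1) ^ 2 := by
  calc #{v | (G.closedNbhdFinset u ∩ G.closedNbhdFinset v).Nonempty}
      = ∑ v with (G.closedNbhdFinset u ∩ G.closedNbhdFinset v).Nonempty, 1 := by simp
    _ ≤ ∑ v with (G.closedNbhdFinset u ∩ G.closedNbhdFinset v).Nonempty,
          #(G.closedNbhdFinset u ∩ G.closedNbhdFinset v) :=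
        Finset.sum_le_sum fun v hv => (mem_filter.1 hv).2.card_pos
    _ ≤ ∑ v, #(G.closedNbhdFinset u ∩ G.closedNbhdFinset v) :=
        Finset.sum_le_sum_of_subset (filter_subset _ _)
    _ ≤ (G.degree u + 1) * (d + 1) := G.sum_card_inter_closedNbhdFinset_le hd u
    _ ≤ (d + 1) ^ 2 := by
        rw [sq]; exact Nat.mul_le_mul_right _ (Nat.succ_le_succ (hd u))

/-- A vertex `v` counted here has `|N[u] ∩ N[v]| ≥ max (1, |N[u]| - 2) ≥ |N[u]| / 3`. -/
theorem card_small_symmDiff_le {d : ℕ} (hd : ∀ v, G.degree v ≤ d) (u : V) :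
    #{v | (G.closedNbhdFinset u ∩ G.closedNbhdFinset v).Nonempty ∧
      #(symmDiff (G.closedNbhdFinset u) (G.closedNbhdFinset v)) ≤ 2} ≤ 3 * (d + 1) := by
  set A : Finset V := {v | (G.closedNbhdFinset u ∩ G.closedNbhdFinset v).Nonempty ∧
      #(symmDiff (G.closedNbhdFinset u) (G.closedNbhdFinset v)) ≤ 2}
  have h1 : ∀ v ∈ A, G.degree u + 1 ≤ 3 * #(G.closedNbhdFinset u ∩ G.closedNbhdFinset v) := by
    intro v hv
    obtain ⟨hne, h2⟩ := (mem_filter.1 hv).2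
    have h3 := hne.card_pos
    have h4 := card_inter_add_card_sdiff (G.closedNbhdFinset u) (G.closedNbhdFinset v)
    have h5 : #(G.closedNbhdFinset u \ G.closedNbhdFinset v) ≤ 2 :=
      (card_le_card le_sup_left).trans h2
    rw [card_closedNbhdFinset] at h4
    omega
  have h2 : #A * (G.degree u + 1) ≤ 3 * (d + 1) * (G.degree u + 1) := by
    calc #A * (G.degree u + 1) = ∑ v ∈ A, (G.degree u + 1) := by simp
      _ ≤ ∑ v ∈ A, 3 * #(G.closedNbhdFinset u ∩ G.closedNbhdFinset v) := Finset.sum_le_sum h1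
      _ ≤ ∑ v, 3 * #(G.closedNbhdFinset u ∩ G.closedNbhdFinset v) :=
          Finset.sum_le_sum_of_subset (subset_univ _)
      _ = 3 * ∑ v, #(G.closedNbhdFinset u ∩ G.closedNbhdFinset v) := by rw [Finset.mul_sum]
      _ ≤ 3 * ((G.degree u + 1) * (d + 1)) :=
          Nat.mul_le_mul_left _ (G.sum_card_inter_closedNbhdFinset_le hd u)
      _ = 3 * (d + 1) * (G.degree u + 1) := by ring
  exact Nat.le_of_mul_le_mul_right h2 (Nat.succ_pos _)

/-! ### Identifying codes as complements of independent sets -/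

/-- The vertex set that must not be removed entirely on account of the pair `(u, v)`: for `u ≠ v`
it is `N[u] Δ N[v]`, the set separating `u` from `v`, and for `u = v` it is `N[u]`, the set
dominating `u`. -/
def codeHyperedge (q : V × V) : Finset V :=
  if q.1 = q.2 then G.closedNbhdFinset q.1
  else symmDiff (G.closedNbhdFinset q.1) (G.closedNbhdFinset q.2)

/-- The pairs that constrain the removal of vertices of `W`. A hyperedge that meets the complement
of `W` is never removed entirely, and a pair with disjoint closed neighbourhoods is separated as soon
as one of its members is dominated. -/
def codePairs (W : Finset V) : Finset (V × V) :=
  {q | (G.closedNbhdFinset q.1 ∩ G.closedNbhdFinset q.2).Nonempty ∧ G.codeHyperedge q ⊆ W}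

variable {G}

theorem isIdentifyingCode_compl {W S : Finset V} (hSW : S ⊆ W)
    (hS : ∀ q ∈ G.codePairs W, ¬ G.codeHyperedge q ⊆ S) :
    G.IsIdentifyingCode ((Sᶜ : Finset V) : Set V) := by
  have hS' : ∀ u v, (G.closedNbhdFinset u ∩ G.closedNbhdFinset v).Nonempty →
      ¬ G.codeHyperedge (u, v) ⊆ S := fun u v hne hsub =>
    hS (u, v) (mem_filter.2 ⟨mem_univ _, hne, hsub.trans hSW⟩) hsub
  have hdom : ∀ v, ¬ G.closedNbhdFinset v ⊆ S := by
    intro v hv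
    refine hS' v v ⟨v, by simp [mem_closedNbhdFinset]⟩ ?_
    simpa [codeHyperedge] using hv
  constructor
  · intro v hv
    obtain ⟨w, hw, hwS⟩ := Finset.not_subset.1 (hdom v)
    have hvS : v ∈ S := by simpa using hv
    refine ⟨w, by simpa using hwS, ?_⟩
    rcases G.mem_closedNbhdFinset.1 hw with rfl | h
    · exact absurd hvS hwS
    · exact h
  · intro u v huv heq
    have hsub : symmDiff (G.closedNbhdFinset u) (G.closedNbhdFinset v) ⊆ S := by
      intro w hw
      by_contra hwS
      have h := Set.ext_iff.1 heq w
      rw [← coe_closedNbhdFinset, ← coe_closedNbhdFinset] at h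
      simp only [Set.mem_inter_iff, mem_coe, mem_compl, hwS, not_false_eq_true, and_true] at h
      rw [Finset.mem_symmDiff] at hw
      tauto
    by_cases hne : (G.closedNbhdFinset u ∩ G.closedNbhdFinset v).Nonempty
    · refine hS' u v hne ?_
      simpa [codeHyperedge, huv] using hsub
    · refine hdom u fun w hw => hsub ?_
      rw [Finset.mem_symmDiff]
      exact Or.inl ⟨hw, fun hw' => hne ⟨w, mem_inter.2 ⟨hw, hw'⟩⟩⟩

theorem coe_symmDiff_closedNbhdFinset (u v : V) :
    ((symmDiff (G.closedNbhdFinset u) (G.closedNbhdFinset v) : Finset V) : Set V) =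
      symmDiff (G.closedNbhd u) (G.closedNbhd v) := by
  rw [Finset.coe_symmDiff, coe_closedNbhdFinset, coe_closedNbhdFinset]

/-- A one-element symmetric difference `N[u] Δ N[v] = {w}` makes `w` forced: if `w = u`, say, then
`u` and `v` are not adjacent, and `v` would belong to the symmetric difference as well. -/
theorem isForced_of_symmDiff_eq_singleton {u v w : V} (huv : u ≠ v)
    (h : symmDiff (G.closedNbhdFinset u) (G.closedNbhdFinset v) = {w}) : G.IsForced w := by
  have hmem : ∀ x, x ∈ symmDiff (G.closedNbhdFinset u) (G.closedNbhdFinset v) ↔ x = w := by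
    simp [h]
  simp only [Finset.mem_symmDiff, mem_closedNbhdFinset] at hmem
  have hu := hmem u
  have hv := hmem v
  rw [G.adj_comm v u] at hu
  refine ⟨u, v, huv, ?_, ?_, ?_⟩
  · rintro rfl
    simp_all
  · rintro rfl
    simp_all
  · rw [← coe_symmDiff_closedNbhdFinset, h, coe_singleton]

theorem TwinFree.two_le_card_codeHyperedge (htf : G.TwinFree) (hdeg : ∀ v, 0 < G.degree v)
    {W : Finset V} (hW : ∀ w ∈ W, ¬ G.IsForced w) {q : V × V} (hq : G.codeHyperedge q ⊆ W) :
    2 ≤ #(G.codeHyperedge q) := by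
  obtain ⟨u, v⟩ := q
  by_cases huv : u = v
  · rw [codeHyperedge, if_pos huv, card_closedNbhdFinset]
    exact Nat.succ_le_succ (hdeg u)
  · simp only [codeHyperedge, if_neg huv] at hq ⊢
    by_contra! hlt
    have h01 : #(symmDiff (G.closedNbhdFinset u) (G.closedNbhdFinset v)) = 0 ∨
        #(symmDiff (G.closedNbhdFinset u) (G.closedNbhdFinset v)) = 1 := by omega
    rcases h01 with h0 | h1
    · rw [card_eq_zero, ← Finset.bot_eq_empty, symmDiff_eq_bot] at h0
      exact htf u v ⟨huv, by rw [← coe_closedNbhdFinset, ← coe_closedNbhdFinset, h0]⟩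
    · obtain ⟨w, hw⟩ := card_eq_one.1 h1
      exact hW w (hq (by simp [hw])) (isForced_of_symmDiff_eq_singleton huv hw)

/-- A bound for the expected number of hyperedges in a set `W` of non-forced vertices that are
selected entirely. The pairs `(u, v)` with `|N[u] Δ N[v]| ≤ 2`, which include the pairs `(u, u)`,
contribute the first summand, all others the second. -/
theorem TwinFree.sum_codePairs_le (htf : G.TwinFree) (hdeg : ∀ v, 0 < G.degree v) {d : ℕ}
    (hd : ∀ v, G.degree v ≤ d) {W : Finset V} (hW : ∀ w ∈ W, ¬ G.IsForced w) {p : ℝ}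
    (hp0 : 0 ≤ p) (hp1 : p ≤ 1) :
    ∑ q ∈ G.codePairs W, p ^ #(G.codeHyperedge q) ≤
      Fintype.card V * (3 * (d + 1) * p ^ 2 + (d + 1) ^ 2 * p ^ 3) := by
  have hterm : ∀ q ∈ G.codePairs W, p ^ #(G.codeHyperedge q) ≤
      (if (G.closedNbhdFinset q.1 ∩ G.closedNbhdFinset q.2).Nonempty ∧
        #(symmDiff (G.closedNbhdFinset q.1) (G.closedNbhdFinset q.2)) ≤ 2 then p ^ 2 else 0) +
      (if (G.closedNbhdFinset q.1 ∩ G.closedNbhdFinset q.2).Nonempty then p ^ 3 else 0) := by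
    intro q hq
    obtain ⟨hne, hqW⟩ := (mem_filter.1 hq).2
    have h2 := htf.two_le_card_codeHyperedge hdeg hW hqW
    rw [if_pos hne]
    by_cases hs : #(symmDiff (G.closedNbhdFinset q.1) (G.closedNbhdFinset q.2)) ≤ 2
    · rw [if_pos ⟨hne, hs⟩]
      have := pow_le_pow_of_le_one hp0 hp1 h2
      have : 0 ≤ p ^ 3 := pow_nonneg hp0 3
      linarith
    · rw [if_neg fun h => hs h.2, zero_add]
      have hq12 : q.1 ≠ q.2 := fun h => hs (by simp [h])
      refine pow_le_pow_of_le_one hp0 hp1 ?_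
      rw [codeHyperedge, if_neg hq12]
      omega
  calc ∑ q ∈ G.codePairs W, p ^ #(G.codeHyperedge q)
      ≤ ∑ q ∈ G.codePairs W, _ := Finset.sum_le_sum hterm
    _ ≤ ∑ q : V × V, _ := by
        refine Finset.sum_le_sum_of_subset_of_nonneg (subset_univ _) fun q _ _ => ?_
        exact add_nonneg (by split_ifs <;> positivity) (by split_ifs <;> positivity)
    _ = ∑ u : V, ∑ v : V, _ := Fintype.sum_prod_type _
    _ ≤ ∑ _u : V, (3 * ((d : ℝ) + 1) * p ^ 2 + ((d : ℝ) + 1) ^ 2 * p ^ 3) := by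
        refine Finset.sum_le_sum fun u _ => ?_
        rw [Finset.sum_add_distrib, ← Finset.sum_filter, ← Finset.sum_filter, Finset.sum_const,
          Finset.sum_const, nsmul_eq_mul, nsmul_eq_mul]
        have h2 := G.card_small_symmDiff_le hd u
        have h3 := G.card_closedNbhdFinset_inter_nonempty_le hd u
        gcongr
        · exact_mod_cast h2
        · exact_mod_cast h3
    _ = Fintype.card V * (3 * (d + 1) * p ^ 2 + (d + 1) ^ 2 * p ^ 3) := by
        rw [Finset.sum_const, nsmul_eq_mul, card_univ]

/-! ### The upper bound on the identifying code number -/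

theorem TwinFree.identifyingCodeNumber_le_of_nonForcedProportion (htf : G.TwinFree) {d : ℕ}
    (hd3 : 3 ≤ d) (hdeg : ∀ v, 0 < G.degree v) (hd : ∀ v, G.degree v ≤ d) {α : ℝ} (hα : 1 ≤ α)
    (hf : G.nonForcedProportion = 1 / α) :
    (G.identifyingCodeNumber : ℝ) ≤
      (Fintype.card V : ℝ) - (Fintype.card V : ℝ) / (103 * α ^ 2 * (d : ℝ)) := by
  classical
  set n : ℝ := (Fintype.card V : ℝ) with hn
  have hα0 : 0 < α := by linarith
  have hd3' : (3 : ℝ) ≤ d := by exact_mod_cast hd3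
  have hn0 : 0 ≤ n := Nat.cast_nonneg _
  set W : Finset V := {v | ¬ G.IsForced v} with hW
  have hWcard : (#W : ℝ) = n / α := by
    have h1 : {v : V | ¬ G.IsForced v}.ncard = #W := by
      rw [← Set.ncard_coe_finset, hW, coe_filter_univ]
    rw [nonForcedProportion, h1, ← hn] at hf
    -- An empty vertex set would give `0 / 0 = 0` here, which is not of the form `1 / α`.
    have hne : n ≠ 0 := by
      intro h0
      rw [h0, div_zero] at hf
      exact (one_div_pos.2 hα0).ne hf
    field_simp at hf ⊢
    linarith
  have hW' : ∀ w ∈ W, ¬ G.IsForced w := fun w hw => (mem_filter.1 hw).2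
  -- With `p = x / (α d)` the set found has size at least `(x - 4 x ^ 2 - 2 x ^ 3) n / (α ^ 2 d)`,
  -- as `3 (d + 1) ≤ 4 d` and `(d + 1) ^ 2 ≤ 2 d ^ 2`; here `x = 1 / 10`.
  set p : ℝ := 1 / (10 * α * d) with hp
  have hden : 1 ≤ 10 * α * (d : ℝ) := by nlinarith
  have hp0 : 0 ≤ p := by positivity
  have hp1 : p ≤ 1 := by
    rw [hp, div_le_one (by linarith)]; exact hden
  obtain ⟨S, hSW, hS, hScard⟩ := exists_independent_of_weight W (G.codePairs W) G.codeHyperedge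
    (fun q hq => card_pos.1 (lt_of_lt_of_le two_pos
      (htf.two_le_card_codeHyperedge hdeg hW' (mem_filter.1 hq).2.2))) hp0 hp1
  have hsum := htf.sum_codePairs_le hdeg hd hW' hp0 hp1
  rw [← hn] at hsum
  rw [hWcard] at hScard
  have hSlarge : n / (103 * α ^ 2 * d) ≤ #S := by
    refine le_trans ?_ (le_trans (sub_le_sub_left hsum _) hScard)
    have hmain : p * (n / α) = n / (α ^ 2 * d) * (1 / 10) := by
      rw [hp]; field_simp
    have h2 : n * (3 * ((d : ℝ) + 1) * p ^ 2) ≤ n / (α ^ 2 * d) * (1 / 25) := by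
      have : n / (α ^ 2 * d) * (1 / 25) = n * (4 * d * p ^ 2) := by
        rw [hp]; field_simp; ring
      have hle : 3 * ((d : ℝ) + 1) ≤ 4 * d := by linarith
      rw [this]
      gcongr
    have h3 : n * (((d : ℝ) + 1) ^ 2 * p ^ 3) ≤ n / (α ^ 2 * d) * (2 / 1000) := by
      have h4 : n * ((2 * d ^ 2) * p ^ 3) = n / (α ^ 2 * d) * (2 / 1000) * (1 / α) := by
        rw [hp]; field_simp; norm_num
      have h5 : n / (α ^ 2 * d) * (2 / 1000) * (1 / α) ≤ n / (α ^ 2 * d) * (2 / 1000) :=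
        mul_le_of_le_one_right (by positivity) ((div_le_one hα0).2 hα)
      refine le_trans ?_ (h4.le.trans h5)
      gcongr
      nlinarith
    have h6 : n / (103 * α ^ 2 * d) = n / (α ^ 2 * d) * (1 / 103) := by
      field_simp
    have h7 : 0 ≤ n / (α ^ 2 * d) := by positivity
    rw [h6, hmain, mul_add]
    linarith
  have hcode : G.identifyingCodeNumber ≤ #Sᶜ :=
    Nat.sInf_le ⟨Sᶜ, isIdentifyingCode_compl hSW hS, rfl⟩
  have hcompl : (#Sᶜ : ℝ) = n - #S := by
    rw [card_compl, Nat.cast_sub (card_le_univ S)]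
  have hcode' : (G.identifyingCodeNumber : ℝ) ≤ #Sᶜ := by exact_mod_cast hcode
  linarith

/-- In a regular graph `N[u] \ N[v]` and `N[v] \ N[u]` have the same size. -/
theorem IsRegularOfDegree.not_isForced {d : ℕ} (h : G.IsRegularOfDegree d) (w : V) :
    ¬ G.IsForced w := by
  rintro ⟨u, v, -, -, -, hw⟩
  rw [← coe_symmDiff_closedNbhdFinset, coe_eq_singleton] at hw
  have h1 : #(symmDiff (G.closedNbhdFinset u) (G.closedNbhdFinset v)) = 1 := by simp [hw]
  have h2 : #(symmDiff (G.closedNbhdFinset u) (G.closedNbhdFinset v)) =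
      #(G.closedNbhdFinset u \ G.closedNbhdFinset v) +
        #(G.closedNbhdFinset v \ G.closedNbhdFinset u) :=
    card_union_of_disjoint disjoint_sdiff_sdiff
  have h3 := card_sdiff_comm (s := G.closedNbhdFinset u) (t := G.closedNbhdFinset v)
    (by simp only [card_closedNbhdFinset, h.degree_eq])
  omega

end SimpleGraph

theorem mainTheorem2 {V : Type*} [Fintype V] (G : SimpleGraph V) [DecidableRel G.Adj]
    (htf : G.TwinFree) (d : ℕ) (hd : 3 ≤ d) :
    ((∀ v : V, 0 < G.degree v) → G.maxDegree = d →
      ∀ α : ℝ, 1 ≤ α → G.nonForcedProportion = 1 / α →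
        (G.identifyingCodeNumber : ℝ) ≤
          (Fintype.card V : ℝ) - (Fintype.card V : ℝ) / (103 * α ^ 2 * (d : ℝ))) ∧
    (G.IsRegularOfDegree d →
      (∀ v : V, ¬ G.IsForced v) ∧
        (G.identifyingCodeNumber : ℝ) ≤
          (Fintype.card V : ℝ) - (Fintype.card V : ℝ) / (103 * (d : ℝ))) := by
  classical
  refine ⟨fun hdeg hmax α hα hf => ?_, fun hreg => ⟨hreg.not_isForced, ?_⟩⟩
  · exact htf.identifyingCodeNumber_le_of_nonForcedProportion hd hdeg
      (fun v => hmax ▸ G.degree_le_maxDegree v) hα hf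
  · rcases isEmpty_or_nonempty V with hV | hV
    · have h0 : G.identifyingCodeNumber = 0 := by
        obtain ⟨C, -, hC⟩ := htf.isLeast_identifyingCodeNumber.1
        rw [← hC, Finset.eq_empty_of_isEmpty C, Finset.card_empty]
      simp [h0]
    · have hf : G.nonForcedProportion = 1 / 1 := by
        have hset : {v : V | ¬ G.IsForced v} = Set.univ :=
          Set.eq_univ_of_forall hreg.not_isForced
        rw [SimpleGraph.nonForcedProportion, hset, Set.ncard_univ, Nat.card_eq_fintype_card,
          div_self (Nat.cast_ne_zero.2 Fintype.card_ne_zero), one_div_one]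
      have := htf.identifyingCodeNumber_le_of_nonForcedProportion hd
        (fun v => by rw [hreg.degree_eq]; omega) (fun v => (hreg.degree_eq v).le) le_rfl hf
      simpa using this
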